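/- Let $D\in\{1,2,3,7,11,19,43,67,163\}$ (the square-free positive integers for which $\mathbb{Q}(\sqrt{-D})$ has class number one), and let $\mathcal{O}_D$ be the ring of integers of $\mathbb{Q}(\sqrt{-D})$. Put $\omega=\frac{1+\sqrt{-D}}{2}$ if $D\equiv 3\pmod 4$ and $\omega=\sqrt{-D}$ otherwise, and identify $(x,y)\in\mathbb{R}^2$ with $x+\omega y\in\mathbb{C}$, so that $\mathcal{O}_D\subset\mathbb{R}^2$. For real $r>0$ let $$C_D(r)=\begin{cases}\{(x,y)\in\mathbb{R}^2: x^2+Dy^2=r\} & \text{if } D\equiv 1,2\pmod 4,\\ \{(x,y)\in\mathbb{R}^2: x^2+xy+\tfrac{1+D}{4}y^2=r\} & \text{if } D\equiv 3\pmod 4,\end{cases}$$ and let $\Lambda_D^r=\mathcal{O}_D\cap C_D(r)$ be the norm $r$ shell. For $j\ge 1$ let $H_{D,j}$ be the real vector space of polynomials in $x,y$ spanned by $\operatorname{Re}(x+\omega y)^j$ and $\operatorname{Im}(x+\omega y)^j$. For a set $T$ of positive integers, a finite nonempty set $X\subset C_D(r)$ is called an ellipsoidal $T$-design if $\sum_{(x,y)\in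 X}P(x,y)=0$ for all $j\in T$ and all $P\in H_{D,j}$; it is said to have strength $T$ if $T$ is maximal (with respect to inclusion) among the sets of positive integers for which $X$ is an ellipsoidal design. Let $u_D=4$ if $D=1$, $u_D=6$ if $D=3$, and $u_D=2$ otherwise, and let $T_D=\mathbb{Z}^+\setminus u_D\mathbb{Z}^+$. Then, for every $r>0$ for which $\Lambda_D^r$ is nonempty, $\Lambda_D^r$ is an ellipsoidal $T_D$-design with strength $T_D$. Moreover, for every positive multiple $j$ of $u_D$, $$\sum_{(x,y)\in\Lambda_D^r}\operatorname{Re}(x+\omega y)^j\neq 0 .$$ -/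

import Mathlib

open MvPolynomial

noncomputable section

namespace EllipsoidalDesign

/-- The square root `√(-D) = i√D` in `ℂ`. -/
def sqrtNeg (D : ℕ) : ℂ := (Real.sqrt D : ℂ) * Complex.I

/-- The generator `ω` of the ring of integers: `(1 + √(-D))/2` if `D ≡ 3 mod 4`,
and `√(-D)` otherwise. -/
def omega (D : ℕ) : ℂ := if D % 4 = 3 then (1 + sqrtNeg D) / 2 else sqrtNeg D

/-- The norm `r` ellipse `C_D(r)` in `ℝ²`. -/
def ellipse (D : ℕ) (r : ℝ) : Set (ℝ × ℝ) :=
  if D % 4 = 3 then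
    {p | p.1 ^ 2 + p.1 * p.2 + (1 + (D : ℝ)) / 4 * p.2 ^ 2 = r}
  else
    {p | p.1 ^ 2 + (D : ℝ) * p.2 ^ 2 = r}

/-- The complex number `x + ω y` with coordinates `(x, y)`. -/
def toComplex (D : ℕ) (p : ℝ × ℝ) : ℂ := (p.1 : ℂ) + omega D * (p.2 : ℂ)

/-- The imaginary quadratic field `ℚ(√(-D))`, as a subfield of `ℂ`. -/
abbrev quadField (D : ℕ) : IntermediateField ℚ ℂ := IntermediateField.adjoin ℚ {sqrtNeg D}

/-- The ring of integers `O_D` of `ℚ(√(-D))`, as a lattice in `ℝ²` through the coordinates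
`(x, y) ↦ x + ω y`. -/
def ringOfIntegersLattice (D : ℕ) : Set (ℝ × ℝ) :=
  {p | ∃ a : NumberField.RingOfIntegers (quadField D), ((a : quadField D) : ℂ) = toComplex D p}

/-- The norm `r` shell `Λ_D^r = O_D ∩ C_D(r)`. -/
def shell (D : ℕ) (r : ℝ) : Set (ℝ × ℝ) := ringOfIntegersLattice D ∩ ellipse D r

/-- The polynomial with real coefficients obtained from a complex polynomial by taking the real
part of each coefficient; at real points it is the real part. -/
def rePart (P : MvPolynomial (Fin 2) ℂ) : MvPolynomial (Fin 2) ℝ :=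
  ∑ m ∈ P.support, monomial m (P.coeff m).re

/-- The polynomial with real coefficients obtained from a complex polynomial by taking the
imaginary part of each coefficient; at real points it is the imaginary part. -/
def imPart (P : MvPolynomial (Fin 2) ℂ) : MvPolynomial (Fin 2) ℝ :=
  ∑ m ∈ P.support, monomial m (P.coeff m).im

/-- The complex polynomial `(x + ω y)^j`. -/
def omegaPow (D j : ℕ) : MvPolynomial (Fin 2) ℂ := (X 0 + C (omega D) * X 1) ^ j

/-- The real vector space `H_{D,j}` spanned by `Re (x + ω y)^j` and `Im (x + ω y)^j`. -/
def harmonicSpace (D j : ℕ) : Submodule ℝ (MvPolynomial (Fin 2) ℝ) :=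
  Submodule.span ℝ {rePart (omegaPow D j), imPart (omegaPow D j)}

/-- A finite nonempty subset `X` of `C_D(r)` is an ellipsoidal `T`-design if every polynomial in
`H_{D,j}` with `j ∈ T` sums to zero over `X`. -/
def IsDesign (D : ℕ) (r : ℝ) (X : Set (ℝ × ℝ)) (T : Set ℕ+) : Prop :=
  X.Finite ∧ X.Nonempty ∧ X ⊆ ellipse D r ∧
    ∀ j ∈ T, ∀ P ∈ harmonicSpace D (j : ℕ), ∑ᶠ p ∈ X, eval ![p.1, p.2] P = 0

/-- `X` has strength `T` if `T` is maximal among the sets of positive integers for which `X` is an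
ellipsoidal design. -/
def HasStrength (D : ℕ) (r : ℝ) (X : Set (ℝ × ℝ)) (T : Set ℕ+) : Prop :=
  Maximal (IsDesign D r X) T

/-- The number `u_D`: `4` if `D = 1`, `6` if `D = 3`, and `2` otherwise. -/
def unitCount (D : ℕ) : ℕ := if D = 1 then 4 else if D = 3 then 6 else 2

/-- The set `T_D` of the positive integers that are not multiples of `u_D`. -/
def designSet (D : ℕ) : Set ℕ+ := {j | ¬ unitCount D ∣ (j : ℕ)}

theorem eval_rePart (P : MvPolynomial (Fin 2) ℂ) (x y : ℝ) :
    eval ![x, y] (rePart P) = (eval ![(x : ℂ), (y : ℂ)] P).re := by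
  rw [rePart, map_sum, eval_eq', Complex.re_sum]
  refine Finset.sum_congr rfl fun m _ => ?_
  rw [eval_monomial, Finsupp.prod_fintype _ _ (by simp)]
  simp only [Fin.prod_univ_two, Matrix.cons_val_zero, Matrix.cons_val_one]
  rw [← Complex.ofReal_pow, ← Complex.ofReal_pow, ← Complex.ofReal_mul, Complex.re_mul_ofReal]

theorem eval_imPart (P : MvPolynomial (Fin 2) ℂ) (x y : ℝ) :
    eval ![x, y] (imPart P) = (eval ![(x : ℂ), (y : ℂ)] P).im := by
  rw [imPart, map_sum, eval_eq', Complex.im_sum]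
  refine Finset.sum_congr rfl fun m _ => ?_
  rw [eval_monomial, Finsupp.prod_fintype _ _ (by simp)]
  simp only [Fin.prod_univ_two, Matrix.cons_val_zero, Matrix.cons_val_one]
  rw [← Complex.ofReal_pow, ← Complex.ofReal_pow, ← Complex.ofReal_mul, Complex.im_mul_ofReal]

end EllipsoidalDesign

end

/-! Under `toComplex` the shell becomes the set of elements of norm r in ℤ[ω], and the design
condition at j says that S_j(r) = ∑ z^j vanishes. Multiplication by a unit ζ permutes the shell, so
S_j(r) = ζ^j S_j(r); a primitive u_D-th root of unity therefore kills S_j(r) when u_D ∤ j.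

Let u_D ∣ j. The shell is stable under conjugation σ, so S_j(r) is real and only has to be nonzero.
Since ℤ[ω] is a UFD, primes can be stripped from an element of norm r (`finsum_normShell_ne_zero`).
A prime p dividing σ p divides the whole shell and contributes p^j. Any other p contributes ∑_{i ≤
k} (p^i (σ p)^(k-i))^j, which is congruent to (σ p)^(kj) mod p and hence nonzero. What remains is
the sum over norm 1, which counts the units.

Unique factorization comes from Lagrange reduction: for the nine discriminants every reduced form
has leading coefficient 1, so a rational prime below a prime ideal P ≠ (p) is a norm
(`exists_gram_of_discr`, `IsQuadraticGenerator.isPrincipalIdealRing`). A principal ideal domain is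
integrally closed, so ℤ[ω] is the full ring of integers. -/

namespace EllipsoidalDesign

/-! ### Power sums over norm shells in a UFD with involution -/

section NormShell

variable {R : Type*} [CommRing R]

/-- The elements of norm `n` for the relative norm `z ↦ z * σ z` of an involution `σ`. -/
def normShell (σ : R ≃+* R) (n : R) : Set R := {z | z * σ z = n}

theorem mul_mem_normShell_iff [IsDomain R] {σ : R ≃+* R} {a n w : R} (ha : a ≠ 0) :
    a * w ∈ normShell σ (a * σ a * n) ↔ w ∈ normShell σ n := by
  have h0 : a * σ a ≠ 0 := mul_ne_zero ha (by simpa using ha)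
  simp only [normShell, Set.mem_ofPred_eq, map_mul]
  rw [show a * w * (σ a * σ w) = a * σ a * (w * σ w) by ring]
  exact ⟨fun h => mul_left_cancel₀ h0 h, fun h => by rw [h]⟩

/-- If `a` divides every element of norm `N(a) n`, the power sum over these elements is `a ^ j`
times the power sum over the elements of norm `n`. -/
theorem finsum_normShell_mul [IsDomain R] {σ : R ≃+* R} {a n : R} (ha : a ≠ 0)
    (hdvd : ∀ y ∈ normShell σ (a * σ a * n), a ∣ y) (j : ℕ) :
    ∑ᶠ z ∈ normShell σ (a * σ a * n), z ^ j = a ^ j * ∑ᶠ z ∈ normShell σ n, z ^ j := by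
  have himg : normShell σ (a * σ a * n) = (a * ·) '' normShell σ n := by
    ext y
    constructor
    · intro hy
      obtain ⟨w, rfl⟩ := hdvd y hy
      exact ⟨w, (mul_mem_normShell_iff ha).1 hy, rfl⟩
    · rintro ⟨w, hw, rfl⟩
      exact (mul_mem_normShell_iff ha).2 hw
  rw [himg, finsum_mem_image (mul_right_injective₀ ha).injOn, mul_finsum_mem]
  simp only [mul_pow]

/-- Exponents of a prime in products with factors prime to it are determined. -/
theorem eq_of_pow_mul_eq_pow_mul [IsDomain R] {p c x y : R} {a b : ℕ}
    (hc : c ≠ 0) (hpc : p ∣ c) (hx : ¬ p ∣ x) (hy : ¬ p ∣ y) (h : c ^ a * x = c ^ b * y) :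
    a = b := by
  have key : ∀ {a b : ℕ} {x y : R}, ¬ p ∣ x → c ^ a * x = c ^ b * y → b ≤ a := by
    intro a b x y hx h
    by_contra! hlt
    obtain ⟨d, rfl⟩ := Nat.exists_eq_add_of_lt hlt
    rw [add_assoc, pow_add, mul_assoc] at h
    have h' := mul_left_cancel₀ (pow_ne_zero a hc) h
    exact hx (h' ▸ Dvd.dvd.mul_right (hpc.trans (dvd_pow_self c (Nat.succ_ne_zero d))) y)
  exact le_antisymm (key hy h.symm) (key hx h)

/-- Splitting off the powers of two primes. -/
theorem exists_eq_pow_mul_pow_mul [IsDomain R] [UniqueFactorizationMonoid R] {p q z : R}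
    (hp : Prime p) (hq : Prime q) (hz : z ≠ 0) :
    ∃ (i l : ℕ) (w : R), z = p ^ i * q ^ l * w ∧ ¬ p ∣ w ∧ ¬ q ∣ w := by
  obtain ⟨z', h1, h1'⟩ :=
    (FiniteMultiplicity.of_prime_left hp hz).exists_eq_pow_mul_and_not_dvd
  have hz' : z' ≠ 0 := fun h => h1' (h ▸ dvd_zero p)
  obtain ⟨w, h2, h2'⟩ :=
    (FiniteMultiplicity.of_prime_left hq hz').exists_eq_pow_mul_and_not_dvd
  refine ⟨multiplicity p z, multiplicity q z', w, ?_, fun h => h1' (by rw [h2]; exact h.mul_left _), h2'⟩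
  rw [mul_assoc, ← h2, ← h1]

theorem prime_apply (σ : R ≃+* R) {p : R} (hp : Prime p) : Prime (σ p) :=
  (MulEquiv.prime_iff (σ : R ≃* R)).2 hp

/-- As σ is an involution, p ∣ σ w amounts to σ p ∣ w. This makes the norm of the cofactor w prime
to p. -/
theorem not_dvd_mul_apply {σ : R ≃+* R} (hσ : ∀ x, σ (σ x) = x) {p w : R} (hp : Prime p)
    (h1 : ¬ p ∣ w) (h2 : ¬ σ p ∣ w) : ¬ p ∣ w * σ w := by
  intro h
  rcases hp.dvd_or_dvd h with h | h
  · exact h1 h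
  · exact h2 (by simpa [hσ] using map_dvd σ h)

/-- Splitting off a prime not associated to its conjugate from the power sum over a norm shell. -/
theorem finsum_normShell_pow_mul [IsDomain R] [UniqueFactorizationMonoid R] {σ : R ≃+* R}
    (hσ : ∀ x, σ (σ x) = x) (hfin : ∀ n, n ≠ 0 → (normShell σ n).Finite) {p m : R} (hp : Prime p)
    (hsplit : ¬ p ∣ σ p) (hm : ¬ p ∣ m) (k j : ℕ) :
    ∑ᶠ z ∈ normShell σ ((p * σ p) ^ k * m), z ^ j =
      (∑ i ∈ Finset.range (k + 1), (p ^ i * σ p ^ (k - i)) ^ j) *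
        ∑ᶠ z ∈ normShell σ m, z ^ j := by
  classical
  have hq := prime_apply σ hp
  have hpq0 : p * σ p ≠ 0 := mul_ne_zero hp.ne_zero hq.ne_zero
  have hm0 : m ≠ 0 := fun h => hm (h ▸ dvd_zero p)
  have hpm : ∀ w ∈ normShell σ m, ¬ p ∣ w := fun w hw h =>
    hm (by rw [← (hw : w * σ w = m)]; exact h.mul_right _)
  have hn0 : (p * σ p) ^ k * m ≠ 0 := mul_ne_zero (pow_ne_zero _ hpq0) hm0
  have hnorm : ∀ i ≤ k, p ^ i * σ p ^ (k - i) * σ (p ^ i * σ p ^ (k - i)) = (p * σ p) ^ k := by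
    intro i hi
    obtain ⟨l, rfl⟩ := Nat.exists_eq_add_of_le hi
    simp only [map_mul, map_pow, hσ, Nat.add_sub_cancel_left]
    ring
  have hne : ∀ i, p ^ i * σ p ^ (k - i) ≠ 0 := fun i =>
    mul_ne_zero (pow_ne_zero _ hp.ne_zero) (pow_ne_zero _ hq.ne_zero)
  rw [finsum_mem_eq_finite_toFinset_sum _ (hfin _ hn0),
    finsum_mem_eq_finite_toFinset_sum _ (hfin _ hm0), Finset.sum_mul_sum, ← Finset.sum_product']
  symm
  refine Finset.sum_bij (fun x _ => p ^ x.1 * σ p ^ (k - x.1) * x.2) ?_ ?_ ?_ ?_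
  · rintro ⟨i, w⟩ h
    simp only [Finset.mem_product, Finset.mem_range, Set.Finite.mem_toFinset] at h ⊢
    rw [← hnorm i (by omega)]
    exact (mul_mem_normShell_iff (hne i)).2 h.2
  · rintro ⟨i, w⟩ h ⟨i', w'⟩ h' heq
    simp only [Finset.mem_product, Finset.mem_range, Set.Finite.mem_toFinset] at h h' heq
    -- The index i is recovered as the exact exponent of p in the product.
    have hnd : ∀ (l : ℕ) (v : R), v ∈ normShell σ m → ¬ p ∣ σ p ^ l * v := by
      intro l v hv hd
      rcases hp.dvd_or_dvd hd with hd | hd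
      · exact hsplit (hp.dvd_of_dvd_pow hd)
      · exact hpm v hv hd
    have hii : i = i' := eq_of_pow_mul_eq_pow_mul hp.ne_zero dvd_rfl (hnd (k - i) w h.2)
      (hnd (k - i') w' h'.2) (by rw [← mul_assoc, ← mul_assoc]; exact heq)
    subst hii
    rw [mul_left_cancel₀ (hne i) heq]
  · intro y hy
    simp only [Set.Finite.mem_toFinset] at hy
    have hy' : y * σ y = (p * σ p) ^ k * m := hy
    have hy0 : y ≠ 0 := by
      rintro rfl
      exact hn0 (by rw [← hy', zero_mul])
    obtain ⟨i, l, w, rfl, hpw, hqw⟩ := exists_eq_pow_mul_pow_mul hp hq hy0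
    -- Compare the exponents of p * σ p in the two expressions for the norm of y.
    have hk : i + l = k := by
      refine eq_of_pow_mul_eq_pow_mul hpq0 (dvd_mul_right _ _)
        (not_dvd_mul_apply hσ hp hpw hqw) hm ?_
      rw [← hy']
      simp only [map_mul, map_pow, hσ]
      ring
    have hl : k - i = l := by omega
    refine ⟨(i, w), ?_, by simp only [hl]⟩
    simp only [Finset.mem_product, Finset.mem_range, Set.Finite.mem_toFinset]
    refine ⟨by omega, (mul_mem_normShell_iff (hne i)).1 ?_⟩
    rw [hnorm i (by omega), hl]
    exact hy
  · rintro ⟨i, w⟩ _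
    exact (mul_pow _ _ _).symm

/-- In a unique factorization domain with an involution, the `j`-th power sum over a nonempty norm
shell does not vanish if the one over norm `1` does not. -/
theorem finsum_normShell_ne_zero [IsDomain R] [UniqueFactorizationMonoid R] {σ : R ≃+* R}
    (hσ : ∀ x, σ (σ x) = x) (hfin : ∀ n, n ≠ 0 → (normShell σ n).Finite) {j : ℕ} (hj : j ≠ 0)
    (hone : ∑ᶠ z ∈ normShell σ 1, z ^ j ≠ 0) (z : R) (hz : z ≠ 0) :
    ∑ᶠ y ∈ normShell σ (z * σ z), y ^ j ≠ 0 := by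
  -- Induction along proper divisibility, removing a prime factor of z together with its conjugate.
  have hwf : WellFounded (DvdNotUnit (α := R)) := IsWellFounded.wf
  induction z using hwf.induction with
  | _ z ih =>
  by_cases hu : IsUnit z
  · rw [← mul_one (z * σ z), finsum_normShell_mul hz (fun y _ => hu.dvd)]
    exact mul_ne_zero (pow_ne_zero _ hz) hone
  obtain ⟨p, hirr, hpz⟩ := WfDvdMonoid.exists_irreducible_factor hu hz
  have hp : Prime p := hirr.prime
  -- If p ∣ σ p (inert or ramified), then p ∣ σ y forces σ p ∣ y and so p ∣ y; p divides the whole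
  -- shell.
  by_cases hsplit : p ∣ σ p
  · have hdiv : ∀ y n, y ∈ normShell σ (p * σ p * n) → p ∣ y := by
      intro y n hy
      have hy' : y * σ y = p * σ p * n := hy
      have h1 : p ∣ y * σ y := ⟨σ p * n, by rw [hy', mul_assoc]⟩
      rcases hp.dvd_or_dvd h1 with h | h
      · exact h
      · exact hsplit.trans (by simpa [hσ] using map_dvd σ h)
    obtain ⟨w, rfl⟩ := hpz
    have hw : w ≠ 0 := right_ne_zero_of_mul hz
    rw [map_mul, show p * w * (σ p * σ w) = p * σ p * (w * σ w) by ring,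
      finsum_normShell_mul hp.ne_zero (fun y hy => hdiv y _ hy)]
    exact mul_ne_zero (pow_ne_zero _ hp.ne_zero)
      (ih w ⟨hw, p, hp.not_isUnit, mul_comm _ _⟩ hw)
  · have hq := prime_apply σ hp
    obtain ⟨i, l, w, rfl, hpw, hqw⟩ := exists_eq_pow_mul_pow_mul hp hq hz
    have hw : w ≠ 0 := right_ne_zero_of_mul hz
    have hil : p ∣ p ^ i * σ p ^ l := (hp.dvd_or_dvd hpz).resolve_right hpw
    rw [show p ^ i * σ p ^ l * w * σ (p ^ i * σ p ^ l * w) = (p * σ p) ^ (i + l) * (w * σ w) by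
        simp only [map_mul, map_pow, hσ]; ring,
      finsum_normShell_pow_mul hσ hfin hp hsplit (not_dvd_mul_apply hσ hp hpw hqw)]
    refine mul_ne_zero (fun h => ?_)
      (ih w ⟨hw, _, fun h => hp.not_isUnit (isUnit_of_dvd_unit hil h), mul_comm _ _⟩ hw)
    -- Modulo p only the term without p survives, a power of σ p; vanishing of the sum would give p
    -- ∣ σ p.
    rw [Finset.sum_range_succ'] at h
    have hd : p ∣ ∑ s ∈ Finset.range (i + l),
        (p ^ (s + 1) * σ p ^ (i + l - (s + 1))) ^ j :=
      Finset.dvd_sum fun s _ => dvd_pow ((dvd_pow_self p s.succ_ne_zero).mul_right _) hj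
    have hd' := (dvd_add_right hd).1 (h ▸ dvd_zero p)
    rw [pow_zero, one_mul] at hd'
    exact hsplit (hp.dvd_of_dvd_pow (hp.dvd_of_dvd_pow hd'))

end NormShell

/-! ### Lagrange reduction of binary quadratic forms -/

section Reduction

/-- Lagrange reduction: if the only reduced positive form of the discriminant of
`x² + e x y + m y²` has leading coefficient `1`, then each positive form of that discriminant is the
Gram form of two vectors for the principal form. -/
theorem exists_gram_of_discr {e m : ℤ} (hneg : e ^ 2 - 4 * m < 0)
    (hred : ∀ a b c : ℤ, 0 < a → |b| ≤ a → a ≤ c → b ^ 2 - 4 * a * c = e ^ 2 - 4 * m → a = 1)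
    (n : ℕ) : ∀ a b c : ℤ, 0 < a → a ≤ n → b ^ 2 - 4 * a * c = e ^ 2 - 4 * m →
      ∃ x y u v : ℤ, a = x ^ 2 + e * x * y + m * y ^ 2 ∧
        b = 2 * x * u + e * (x * v + u * y) + 2 * m * y * v ∧
        c = u ^ 2 + e * u * v + m * v ^ 2 := by
  induction n with
  | zero => intro a b c h1 h2; exact absurd h2 (by push_cast; omega)
  | succ n ih =>
    intro a b c ha han hd
    obtain ⟨k, hk⟩ : ∃ k : ℤ, |b + 2 * a * k| ≤ a := by
      -- Rounding -b / (2a) to an integer puts b + 2ak in [-a, a).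
      refine ⟨-((b + a) / (2 * a)), ?_⟩
      have h1 := Int.emod_add_mul_ediv (b + a) (2 * a)
      have h2 := Int.emod_nonneg (b + a) (by omega : 2 * a ≠ 0)
      have h3 := Int.emod_lt_of_pos (b + a) (by omega : 0 < 2 * a)
      rw [abs_le]
      constructor <;> linarith
    obtain ⟨b', hb'⟩ : ∃ b', b' = b + 2 * a * k := ⟨_, rfl⟩
    obtain ⟨c', hc'⟩ : ∃ c', c' = c + b * k + a * k ^ 2 := ⟨_, rfl⟩
    have hd' : b' ^ 2 - 4 * a * c' = e ^ 2 - 4 * m := by rw [← hd, hb', hc']; ring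
    rw [← hb'] at hk
    suffices h : ∃ x y u v : ℤ, a = x ^ 2 + e * x * y + m * y ^ 2 ∧
        b' = 2 * x * u + e * (x * v + u * y) + 2 * m * y * v ∧
        c' = u ^ 2 + e * u * v + m * v ^ 2 by
      obtain ⟨x, y, u, v, h1, h2, h3⟩ := h
      refine ⟨x, y, u - k * x, v - k * y, h1, ?_, ?_⟩
      · linear_combination h2 - hb' - 2 * k * h1
      · linear_combination h3 - hc' - k * h2 + k * hb' + k ^ 2 * h1
    rcases le_or_gt a c' with hac | hac
    · have ha1 := hred a b' c' ha hk hac hd'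
      subst ha1
      -- Equal discriminants force b' ≡ e mod 2, so the form is the Gram form of (1, 0) and (t, 1).
      have hpar : (2 : ℤ) ∣ b' - e := by
        have h4 : (2 : ℤ) ∣ (b' - e) * (b' + e) := ⟨2 * (c' - m), by linear_combination hd'⟩
        rcases Int.prime_two.dvd_or_dvd h4 with h | h
        · exact h
        · omega
      obtain ⟨t, ht⟩ := hpar
      obtain rfl : b' = 2 * t + e := by linarith
      refine ⟨1, 0, t, 1, by ring, by ring, ?_⟩
      linarith [hd', show (2 * t + e) ^ 2 = 4 * (t ^ 2 + e * t) + e ^ 2 by ring]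
    -- Not yet reduced: swap the outer coefficients and recurse on the smaller leading coefficient
    -- c'.
    · have hc0 : 0 < c' := by
        by_contra! h
        nlinarith [sq_nonneg b', mul_nonneg ha.le (neg_nonneg.2 h)]
      obtain ⟨x, y, u, v, h1, h2, h3⟩ := ih c' (-b') a hc0 (by push_cast at han; omega)
        (by linear_combination hd')
      exact ⟨u, v, -x, -y, h3, by linear_combination -h2, by linear_combination h1⟩

end Reduction

/-! ### The order ℤ[ω] and its ideals -/

section QuadraticOrder

open ComplexConjugate

/-- A non-real complex number with integral trace `e` and norm `m`. -/
structure IsQuadraticGenerator (ω : ℂ) (e m : ℤ) : Prop where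
  add_conj : ω + conj ω = e
  mul_conj : ω * conj ω = m
  im_ne_zero : ω.im ≠ 0

/-- The ring `ℤ[ω]`. -/
abbrev quadraticOrder (ω : ℂ) : Subring ℂ := Subring.closure {ω}

variable {ω : ℂ} {e m : ℤ}

theorem IsQuadraticGenerator.conj_eq (h : IsQuadraticGenerator ω e m) : conj ω = e - ω := by
  rw [← h.add_conj]; ring

theorem IsQuadraticGenerator.mul_self (h : IsQuadraticGenerator ω e m) : ω * ω = e * ω - m := by
  rw [← h.add_conj, ← h.mul_conj]; ring

theorem IsQuadraticGenerator.discr_neg (h : IsQuadraticGenerator ω e m) :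
    e ^ 2 - 4 * m < 0 := by
  have h1 := congrArg Complex.re h.add_conj
  have h2 := congrArg Complex.re h.mul_conj
  simp only [Complex.add_re, Complex.conj_re, Complex.mul_re, Complex.conj_im,
    Complex.intCast_re] at h1 h2
  have h3 : ((e ^ 2 - 4 * m : ℤ) : ℝ) < 0 := by
    push_cast
    rw [← h1, ← h2]
    nlinarith [sq_pos_of_ne_zero h.im_ne_zero]
  exact_mod_cast h3

theorem IsQuadraticGenerator.mem_iff (h : IsQuadraticGenerator ω e m) {z : ℂ} :
    z ∈ quadraticOrder ω ↔ ∃ x y : ℤ, z = x + y * ω := by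
  constructor
  · intro hz
    induction hz using Subring.closure_induction with
    | mem x hx => exact ⟨0, 1, by rw [Set.mem_singleton_iff.1 hx]; simp⟩
    | zero => exact ⟨0, 0, by simp⟩
    | one => exact ⟨1, 0, by simp⟩
    | add z w _ _ hz hw =>
      obtain ⟨x, y, rfl⟩ := hz
      obtain ⟨u, v, rfl⟩ := hw
      exact ⟨x + u, y + v, by push_cast; ring⟩
    | neg z _ hz =>
      obtain ⟨x, y, rfl⟩ := hz
      exact ⟨-x, -y, by push_cast; ring⟩
    | mul z w _ _ hz hw =>
      obtain ⟨x, y, rfl⟩ := hz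
      obtain ⟨u, v, rfl⟩ := hw
      refine ⟨x * u - m * y * v, x * v + y * u + e * y * v, ?_⟩
      push_cast
      linear_combination (y * v : ℂ) * h.mul_self
  · rintro ⟨x, y, rfl⟩
    exact add_mem (intCast_mem _ x)
      (mul_mem (intCast_mem _ y) (Subring.subset_closure (Set.mem_singleton ω)))

theorem IsQuadraticGenerator.conj_mem (h : IsQuadraticGenerator ω e m) {z : ℂ}
    (hz : z ∈ quadraticOrder ω) : conj z ∈ quadraticOrder ω := by
  obtain ⟨x, y, rfl⟩ := h.mem_iff.1 hz
  refine h.mem_iff.2 ⟨x + e * y, -y, ?_⟩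
  simp only [map_add, map_mul, map_intCast, h.conj_eq]
  push_cast
  ring

/-- Complex conjugation on `ℤ[ω]`. -/
def IsQuadraticGenerator.conjEquiv (h : IsQuadraticGenerator ω e m) :
    quadraticOrder ω ≃+* quadraticOrder ω :=
  (starRingAut (R := ℂ)).restrict (quadraticOrder ω) (quadraticOrder ω) fun z =>
    ⟨fun hz => h.conj_mem hz, fun hz => by simpa using h.conj_mem hz⟩

@[simp]
theorem IsQuadraticGenerator.coe_conjEquiv (h : IsQuadraticGenerator ω e m)
    (z : quadraticOrder ω) : (h.conjEquiv z : ℂ) = conj (z : ℂ) := rfl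

theorem IsQuadraticGenerator.conjEquiv_conjEquiv (h : IsQuadraticGenerator ω e m)
    (z : quadraticOrder ω) : h.conjEquiv (h.conjEquiv z) = z := by
  apply Subtype.ext
  simp

theorem IsQuadraticGenerator.normSq_eq (h : IsQuadraticGenerator ω e m) (x y : ℝ) :
    Complex.normSq (x + y * ω) = x ^ 2 + e * x * y + m * y ^ 2 := by
  apply Complex.ofReal_injective
  rw [Complex.normSq_eq_conj_mul_self]
  simp only [map_add, map_mul, Complex.conj_ofReal, h.conj_eq]
  push_cast
  linear_combination -(y : ℂ) ^ 2 * h.mul_self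

/-- The elements of `ℤ[ω]` of given norm are finite in number. -/
theorem IsQuadraticGenerator.finite_normSq (h : IsQuadraticGenerator ω e m) (r : ℝ) :
    {z : ℂ | z ∈ quadraticOrder ω ∧ Complex.normSq z = r}.Finite := by
  -- Completing the square, 4r = (2x + ey)² + (4m - e²)y² with 4m - e² ≥ 1, so N bounds both
  -- squares.
  obtain ⟨N, hN⟩ := exists_nat_ge (4 * |r| + 1)
  have hd := h.discr_neg
  refine ((((Set.finite_Icc (-(N : ℤ) * (1 + |e|)) (N * (1 + |e|))).prod
    (Set.finite_Icc (-(N : ℤ)) N))).image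
      fun q : ℤ × ℤ => (q.1 : ℂ) + q.2 * ω).subset ?_
  rintro z ⟨hz, hr⟩
  obtain ⟨x, y, rfl⟩ := h.mem_iff.1 hz
  refine ⟨(x, y), ?_, rfl⟩
  have h1 := h.normSq_eq x y
  push_cast at h1
  rw [hr] at h1
  have h2 : ((2 * x + e * y) ^ 2 + (4 * m - e ^ 2) * y ^ 2 : ℤ) ≤ (N : ℤ) := by
    have : (((2 * x + e * y) ^ 2 + (4 * m - e ^ 2) * y ^ 2 : ℤ) : ℝ) = 4 * r := by
      rw [h1]; push_cast; ring
    have : (((2 * x + e * y) ^ 2 + (4 * m - e ^ 2) * y ^ 2 : ℤ) : ℝ) ≤ (N : ℤ) := by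
      rw [this]
      push_cast
      linarith [le_abs_self r]
    exact_mod_cast this
  have hy2 : y ^ 2 ≤ N := by nlinarith [sq_nonneg (2 * x + e * y), sq_nonneg y]
  have ht2 : (2 * x + e * y) ^ 2 ≤ N := by nlinarith [sq_nonneg y]
  have hy : |y| ≤ N := by
    rw [← sq_abs] at hy2
    nlinarith [abs_nonneg y]
  have ht : |2 * x + e * y| ≤ N := by
    rw [← sq_abs] at ht2
    nlinarith [abs_nonneg (2 * x + e * y)]
  have hx : |x| ≤ N * (1 + |e|) := by
    have h3 : |2 * x| ≤ |2 * x + e * y| + |e * y| := by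
      have := abs_sub (2 * x + e * y) (e * y)
      rwa [add_sub_cancel_right] at this
    rw [abs_mul, abs_mul] at h3
    have h4 : |e| * |y| ≤ |e| * N := mul_le_mul_of_nonneg_left hy (abs_nonneg e)
    have h5 : |(2 : ℤ)| = 2 := rfl
    rw [h5] at h3
    nlinarith [abs_nonneg x, abs_nonneg e, mul_nonneg (abs_nonneg e) (Int.natCast_nonneg N)]
  rw [abs_le] at hx hy
  exact ⟨⟨by linarith [hx.1], hx.2⟩, hy⟩

/-- If the only reduced form of discriminant `e² - 4m` is the principal one, then `ℤ[ω]` is a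
principal ideal ring. -/
theorem IsQuadraticGenerator.isPrincipalIdealRing (h : IsQuadraticGenerator ω e m)
    (hred : ∀ a b c : ℤ, 0 < a → |b| ≤ a → a ≤ c → b ^ 2 - 4 * a * c = e ^ 2 - 4 * m → a = 1) :
    IsPrincipalIdealRing (quadraticOrder ω) := by
  obtain ⟨W, hW⟩ : ∃ W : quadraticOrder ω, (W : ℂ) = ω :=
    ⟨⟨ω, Subring.subset_closure (Set.mem_singleton ω)⟩, rfl⟩
  have hWW : W * W = e * W - m := by
    apply Subtype.ext
    push_cast
    rw [hW, h.mul_self]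
  have hcoord : ∀ z : quadraticOrder ω, ∃ x y : ℤ, z = x + y * W := by
    intro z
    obtain ⟨x, y, hz⟩ := h.mem_iff.1 z.2
    refine ⟨x, y, Subtype.ext ?_⟩
    push_cast
    rw [hW, hz]
  have hnorm : ∀ x y : ℤ, ((x : quadraticOrder ω) + y * W) * (x + y * (e - W)) =
      ((x ^ 2 + e * x * y + m * y ^ 2 : ℤ) : quadraticOrder ω) := by
    intro x y
    push_cast
    linear_combination -(y : quadraticOrder ω) ^ 2 * hWW
  refine IsPrincipalIdealRing.of_prime_ne_bot fun P hP hP0 => ?_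
  obtain ⟨p, hp0, hpp, hpP⟩ : ∃ p : ℤ, 0 < p ∧ Prime p ∧
      ∀ n : ℤ, (n : quadraticOrder ω) ∈ P ↔ p ∣ n := by
    set Q : Ideal ℤ := P.comap (Int.castRingHom (quadraticOrder ω)) with hQ
    have hmem : ∀ n : ℤ, (n : quadraticOrder ω) ∈ P ↔ Submodule.IsPrincipal.generator Q ∣ n := by
      intro n
      rw [← Submodule.IsPrincipal.mem_iff_generator_dvd, hQ, Ideal.mem_comap]
      rfl
    have hQ0 : Q ≠ ⊥ := by
      intro hbot
      obtain ⟨z, hz, hz0⟩ := Submodule.exists_mem_ne_zero_of_ne_bot hP0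
      obtain ⟨x, y, rfl⟩ := hcoord z
      have h1 : (x ^ 2 + e * x * y + m * y ^ 2 : ℤ) ∈ Q := by
        rw [hQ, Ideal.mem_comap, eq_intCast, ← hnorm]
        exact P.mul_mem_right _ hz
      rw [hbot, Ideal.mem_bot] at h1
      have hd := h.discr_neg
      have hy : y = 0 := by
        by_contra hy
        have := sq_pos_of_ne_zero hy
        nlinarith [sq_nonneg (2 * x + e * y)]
      subst hy
      have hx : x = 0 := by simpa using h1
      subst hx
      simp at hz0
    have hgp : Prime (Submodule.IsPrincipal.generator Q) :=
      Submodule.IsPrincipal.prime_generator_of_isPrime Q hQ0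
    refine ⟨|Submodule.IsPrincipal.generator Q|, abs_pos.2 hgp.ne_zero, ?_, fun n => ?_⟩
    · rcases abs_choice (Submodule.IsPrincipal.generator Q) with h1 | h1 <;> rw [h1]
      exacts [hgp, hgp.neg]
    · rw [hmem, abs_dvd]
  have hpmem : (p : quadraticOrder ω) ∈ P := (hpP p).2 dvd_rfl
  -- If p divides every W-coordinate in P, then it divides the other coordinates too and P = (p).
  by_cases hall : ∀ x y : ℤ, (x : quadraticOrder ω) + y * W ∈ P → p ∣ y
  · refine ⟨⟨(p : quadraticOrder ω), le_antisymm (fun z hz => ?_)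
      ((Ideal.span_singleton_le_iff_mem P).2 hpmem)⟩⟩
    obtain ⟨x, y, rfl⟩ := hcoord z
    obtain ⟨y', rfl⟩ := hall x y hz
    have hx : p ∣ x := by
      rw [← hpP]
      have := P.sub_mem hz (P.mul_mem_right (y' * W) hpmem)
      convert this using 1
      push_cast
      ring
    obtain ⟨x', rfl⟩ := hx
    exact Ideal.mem_span_singleton'.2 ⟨x' + y' * W, by push_cast; ring⟩
  push Not at hall
  obtain ⟨x₀, y₀, hz₀, hy₀⟩ := hall
  obtain ⟨s, t, hst⟩ := (hpp.coprime_iff_not_dvd.2 hy₀ : IsCoprime p y₀)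
  have hst' : (s : quadraticOrder ω) * p + t * y₀ = 1 := by exact_mod_cast hst
  -- Since y₀ is invertible mod p, the W-coordinate can be normalised to 1.
  obtain ⟨b, hb⟩ : ∃ b : ℤ, (b : quadraticOrder ω) + W ∈ P := by
    refine ⟨t * x₀, ?_⟩
    have := P.add_mem (P.mul_mem_left (t : quadraticOrder ω) hz₀)
      (P.mul_mem_left (s * W) hpmem)
    convert this using 1
    push_cast
    linear_combination -W * hst'
  obtain ⟨c, hc⟩ : p ∣ b ^ 2 + e * b * 1 + m * 1 ^ 2 := by
    rw [← hpP, ← hnorm]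
    exact P.mul_mem_right _ (by simpa using hb)
  -- The form (p, 2b + e, c) has discriminant e² - 4m, so reduction shows that p is a norm. As P is
  -- prime, it contains an element ρ of norm p or its conjugate.
  obtain ⟨x, y, _, _, hxy, -, -⟩ := exists_gram_of_discr h.discr_neg hred p.toNat p (2 * b + e) c
    hp0 (by rw [Int.toNat_of_nonneg hp0.le]) (by linear_combination 4 * hc)
  obtain ⟨u, v, huv, hρ⟩ : ∃ u v : ℤ, p = u ^ 2 + e * u * v + m * v ^ 2 ∧
      (u : quadraticOrder ω) + v * W ∈ P := by
    have h1 : ((x : quadraticOrder ω) + y * W) * (x + y * (e - W)) ∈ P := by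
      rw [hnorm, ← hxy]
      exact hpmem
    rcases hP.mem_or_mem h1 with h1 | h1
    · exact ⟨x, y, hxy, h1⟩
    · refine ⟨x + e * y, -y, by rw [hxy]; ring, ?_⟩
      convert h1 using 1
      push_cast
      ring
  have hpρ : ∃ d, (p : quadraticOrder ω) = (u + v * W) * d := ⟨_, by rw [hnorm, ← huv]⟩
  -- If p ∣ v then p ∣ u as well, and p² would divide the norm p.
  have hv : ¬ p ∣ v := by
    rintro ⟨v', rfl⟩
    obtain ⟨u', rfl⟩ : p ∣ u := by
      rw [← hpP]
      have := P.sub_mem hρ (P.mul_mem_right (v' * W) hpmem)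
      convert this using 1
      push_cast
      ring
    have h1 : p * 1 = p * (p * (u' ^ 2 + e * u' * v' + m * v' ^ 2)) := by
      linear_combination huv
    exact hpp.not_isUnit (IsUnit.of_mul_eq_one _ (mul_left_cancel₀ hpp.ne_zero h1).symm)
  obtain ⟨s', t', hst₂⟩ := (hpp.coprime_iff_not_dvd.2 hv : IsCoprime p v)
  have hst₂' : (s' : quadraticOrder ω) * p + t' * v = 1 := by exact_mod_cast hst₂
  -- W ≡ -b mod P, so X + YW in P puts the integer X - Yb in P. Hence P is generated by p and b + W,
  -- and ρ need only divide these two.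
  have hdiff : ∀ X Y : ℤ, (X : quadraticOrder ω) + Y * W ∈ P → p ∣ X - Y * b := by
    intro X Y hXY
    rw [← hpP]
    have := P.sub_mem hXY (P.mul_mem_left (Y : quadraticOrder ω) hb)
    convert this using 1
    push_cast
    ring
  obtain ⟨d, hd⟩ := hpρ
  have hbρ : ∃ d', (b : quadraticOrder ω) + W = (u + v * W) * d' := by
    obtain ⟨k, hk⟩ := hdiff u v hρ
    have hk' : (u : quadraticOrder ω) - v * b = p * k := by exact_mod_cast hk
    refine ⟨s' * d * (b + W) + t' * (1 - d * k), ?_⟩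
    linear_combination -(b + W) * hst₂' + s' * (b + W) * hd - t' * hk' - t' * k * hd
  obtain ⟨d', hd'⟩ := hbρ
  refine ⟨⟨(u : quadraticOrder ω) + v * W, le_antisymm (fun z hz => ?_)
    ((Ideal.span_singleton_le_iff_mem P).2 hρ)⟩⟩
  obtain ⟨X, Y, rfl⟩ := hcoord z
  obtain ⟨k, hk⟩ := hdiff X Y hz
  have hk' : (X : quadraticOrder ω) - Y * b = p * k := by exact_mod_cast hk
  refine Ideal.mem_span_singleton'.2 ⟨Y * d' + k * d, ?_⟩
  linear_combination -Y * hd' - k * hd - hk'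

end QuadraticOrder

end EllipsoidalDesign

noncomputable section

namespace EllipsoidalDesign

/-! ### Power sums over shells of ℤ[ω] in ℂ -/

section PowerSums

open ComplexConjugate

variable {ω : ℂ} {e m : ℤ}

/-- The elements of `ℤ[ω]` of norm `r`. -/
def complexShell (ω : ℂ) (r : ℝ) : Set ℂ := {z | z ∈ quadraticOrder ω ∧ Complex.normSq z = r}

theorem IsQuadraticGenerator.image_normShell (h : IsQuadraticGenerator ω e m)
    (z : quadraticOrder ω) :
    Subtype.val '' normShell h.conjEquiv (z * h.conjEquiv z) =
      complexShell ω (Complex.normSq z) := by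
  have key : ∀ y : quadraticOrder ω, y ∈ normShell h.conjEquiv (z * h.conjEquiv z) ↔
      Complex.normSq y = Complex.normSq z := by
    intro y
    rw [← Complex.ofReal_inj, ← Complex.mul_conj, ← Complex.mul_conj]
    exact Subtype.ext_iff
  ext y
  constructor
  · rintro ⟨y, hy, rfl⟩
    exact ⟨y.2, (key y).1 hy⟩
  · rintro ⟨hy, hr⟩
    exact ⟨⟨y, hy⟩, (key _).2 hr, rfl⟩

theorem IsQuadraticGenerator.finite_normShell (h : IsQuadraticGenerator ω e m)
    (n : quadraticOrder ω) : (normShell h.conjEquiv n).Finite := by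
  rcases (normShell h.conjEquiv n).eq_empty_or_nonempty with h0 | ⟨z, hz⟩
  · rw [h0]; exact Set.finite_empty
  · obtain rfl : z * h.conjEquiv z = n := hz
    refine Set.Finite.of_finite_image ?_ Subtype.val_injective.injOn
    rw [h.image_normShell]
    exact h.finite_normSq _

/-- Nonvanishing of the power sums over a norm shell of `ℤ[ω]`. -/
theorem IsQuadraticGenerator.finsum_complexShell_ne_zero (h : IsQuadraticGenerator ω e m)
    [IsPrincipalIdealRing (quadraticOrder ω)] {j : ℕ} (hj : j ≠ 0)
    (hunit : ∀ z ∈ complexShell ω 1, z ^ j = 1) {r : ℝ} (hr : r ≠ 0)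
    (hne : (complexShell ω r).Nonempty) : ∑ᶠ z ∈ complexShell ω r, z ^ j ≠ 0 := by
  obtain ⟨z, hz, rfl⟩ := hne
  have hz0 : (⟨z, hz⟩ : quadraticOrder ω) ≠ 0 := fun h0 =>
    hr (by rw [Subtype.ext_iff] at h0; simpa using h0)
  -- Every summand is 1, so the sum is the number of elements of norm 1, nonzero in characteristic
  -- 0.
  have hone : ∑ᶠ y ∈ normShell h.conjEquiv 1, y ^ j ≠ 0 := by
    have h1 : ∀ y ∈ normShell h.conjEquiv 1, y ^ j = 1 := by
      intro y hy
      apply Subtype.ext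
      refine hunit y ?_
      have := (h.image_normShell 1).subset ⟨y, by simpa using hy, rfl⟩
      simpa using this
    rw [finsum_mem_congr rfl h1, finsum_mem_eq_finite_toFinset_sum _ (h.finite_normShell 1),
      Finset.sum_const, nsmul_one, Nat.cast_ne_zero, ← Nat.pos_iff_ne_zero, Finset.card_pos]
    exact ⟨1, by simp [normShell]⟩
  have hmain := finsum_normShell_ne_zero h.conjEquiv_conjEquiv
    (fun n _ => h.finite_normShell n) hj hone ⟨z, hz⟩ hz0
  have hcoe := (quadraticOrder ω).subtype.toAddMonoidHom.map_finsum_mem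
    (fun y : quadraticOrder ω => y ^ j)
    (h.finite_normShell (⟨z, hz⟩ * h.conjEquiv ⟨z, hz⟩))
  rw [← h.image_normShell ⟨z, hz⟩, finsum_mem_image Subtype.val_injective.injOn]
  intro h0
  refine hmain (Subtype.ext ?_)
  refine Eq.trans hcoe (Eq.trans ?_ h0)
  rfl

/-- Conjugation permutes the shell. The sum is thus real, so its nonvanishing is that of its real
part. -/
theorem IsQuadraticGenerator.conj_finsum_complexShell (h : IsQuadraticGenerator ω e m) (r : ℝ)
    (j : ℕ) : conj (∑ᶠ z ∈ complexShell ω r, z ^ j) = ∑ᶠ z ∈ complexShell ω r, z ^ j := by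
  have h1 := (starRingEnd ℂ).toAddMonoidHom.map_finsum_mem
    (fun z : ℂ => z ^ j) (h.finite_normSq r)
  refine Eq.trans h1 (finsum_mem_eq_of_bijOn conj ⟨?_, ?_, ?_⟩ fun z _ =>
    map_pow (starRingEnd ℂ) z j)
  · rintro z ⟨hz, hr⟩
    exact ⟨h.conj_mem hz, by rw [Complex.normSq_conj, hr]⟩
  · exact (RingHom.injective _).injOn
  · rintro z ⟨hz, hr⟩
    exact ⟨conj z, ⟨h.conj_mem hz, by rw [Complex.normSq_conj, hr]⟩, Complex.conj_conj z⟩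

/-- A unit whose `j`-th power is not `1` makes the `j`-th power sums over norm shells vanish. -/
theorem IsQuadraticGenerator.finsum_complexShell_eq_zero (h : IsQuadraticGenerator ω e m)
    {ζ : ℂ} (hζ : ζ ∈ complexShell ω 1) {j : ℕ} (hj : ζ ^ j ≠ 1) (r : ℝ) :
    ∑ᶠ z ∈ complexShell ω r, z ^ j = 0 := by
  have hζ' : ζ * conj ζ = 1 := by rw [Complex.mul_conj, hζ.2, Complex.ofReal_one]
  have hζ0 : ζ ≠ 0 := left_ne_zero_of_mul_eq_one hζ'
  have h1 : ∑ᶠ z ∈ complexShell ω r, ζ ^ j * z ^ j = ∑ᶠ z ∈ complexShell ω r, z ^ j := by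
    -- Multiplication by ζ permutes the shell, with inverse multiplication by its conjugate.
    refine finsum_mem_eq_of_bijOn (ζ * ·) ⟨?_, ?_, ?_⟩ fun z _ => (mul_pow _ _ _).symm
    · rintro z ⟨hz, hr⟩
      exact ⟨mul_mem hζ.1 hz, by rw [Complex.normSq_mul, hζ.2, hr, one_mul]⟩
    · exact (mul_right_injective₀ hζ0).injOn
    · rintro z ⟨hz, hr⟩
      refine ⟨conj ζ * z, ⟨mul_mem (h.conj_mem hζ.1) hz, ?_⟩, ?_⟩
      · rw [Complex.normSq_mul, Complex.normSq_conj, hζ.2, hr, one_mul]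
      · simp only
        rw [← mul_assoc, hζ', one_mul]
  rw [← mul_finsum_mem] at h1
  exact (mul_left_eq_self₀.1 h1).resolve_left hj

end PowerSums

/-! ### The generator ω: ring of integers, class number one, units -/

section Omega

open ComplexConjugate

/-- The trace of `omega D`. -/
def omegaTrace (D : ℕ) : ℤ := if D % 4 = 3 then 1 else 0

/-- The norm of `omega D`. -/
def omegaNorm (D : ℕ) : ℤ := if D % 4 = 3 then (1 + D) / 4 else D

theorem sqrtNeg_mul_self (D : ℕ) : sqrtNeg D * sqrtNeg D = -(D : ℂ) := by
  have h : ((Real.sqrt D : ℂ)) * (Real.sqrt D : ℂ) = D := by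
    rw [← Complex.ofReal_mul, Real.mul_self_sqrt (Nat.cast_nonneg D), Complex.ofReal_natCast]
  unfold sqrtNeg
  linear_combination (Complex.I * Complex.I) * h + (D : ℂ) * Complex.I_mul_I

theorem conj_sqrtNeg (D : ℕ) : conj (sqrtNeg D) = -sqrtNeg D := by
  simp [sqrtNeg]

theorem sqrtNeg_im (D : ℕ) : (sqrtNeg D).im = Real.sqrt D := by
  simp [sqrtNeg]

theorem isQuadraticGenerator_omega {D : ℕ} (hD : 0 < D) :
    IsQuadraticGenerator (omega D) (omegaTrace D) (omegaNorm D) := by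
  have him : (sqrtNeg D).im ≠ 0 := by
    rw [sqrtNeg_im]
    exact (Real.sqrt_pos.2 (Nat.cast_pos.2 hD)).ne'
  by_cases h3 : D % 4 = 3
  · have hm : ((4 * ((1 + (D : ℤ)) / 4) : ℤ) : ℂ) = ((1 + D : ℤ) : ℂ) := by
      congr 1
      omega
    push_cast at hm
    refine ⟨?_, ?_, ?_⟩ <;> simp only [omega, omegaTrace, omegaNorm, h3, if_true]
    · simp only [map_div₀, map_add, map_one, conj_sqrtNeg, map_ofNat]
      push_cast
      ring
    · simp only [map_div₀, map_add, map_one, conj_sqrtNeg, map_ofNat]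
      linear_combination -(1 / 4 : ℂ) * sqrtNeg_mul_self D - (1 / 4 : ℂ) * hm
    · simpa using him
  · refine ⟨?_, ?_, ?_⟩ <;> simp only [omega, omegaTrace, omegaNorm, h3, if_false]
    · rw [conj_sqrtNeg]; simp
    · rw [conj_sqrtNeg, mul_neg, sqrtNeg_mul_self]; simp
    · exact him

theorem mem_ellipse_iff {D : ℕ} (hD : 0 < D) (r : ℝ) (p : ℝ × ℝ) :
    p ∈ ellipse D r ↔ Complex.normSq (toComplex D p) = r := by
  have h := (isQuadraticGenerator_omega hD).normSq_eq p.1 p.2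
  rw [toComplex, mul_comm, h]
  by_cases h3 : D % 4 = 3
  · have hm : ((4 * ((1 + (D : ℤ)) / 4) : ℤ) : ℝ) = ((1 + D : ℤ) : ℝ) := by
      congr 1
      omega
    push_cast at hm
    simp only [ellipse, omegaTrace, omegaNorm, h3, if_true, Set.mem_ofPred_eq]
    rw [show (1 + (D : ℝ)) / 4 = (((1 + (D : ℤ)) / 4 : ℤ) : ℝ) by linarith]
    push_cast
    rw [one_mul]
  · simp [ellipse, omegaTrace, omegaNorm, h3]

theorem toComplex_injective {D : ℕ} (hD : 0 < D) : Function.Injective (toComplex D) := by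
  rintro ⟨x, y⟩ ⟨u, v⟩ h
  have hi := congrArg Complex.im h
  simp only [toComplex, Complex.add_im, Complex.ofReal_im, Complex.im_mul_ofReal, zero_add] at hi
  have hyv : y = v := mul_left_cancel₀ (isQuadraticGenerator_omega hD).im_ne_zero hi
  subst hyv
  simpa [toComplex] using h

theorem toComplex_intCast (D : ℕ) (x y : ℤ) :
    toComplex D ((x : ℝ), (y : ℝ)) = x + y * omega D := by
  simp [toComplex, mul_comm]

theorem sqrtNeg_mem (D : ℕ) : sqrtNeg D ∈ quadraticOrder (omega D) := by
  have h : omega D ∈ quadraticOrder (omega D) := Subring.subset_closure (Set.mem_singleton _)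
  by_cases h3 : D % 4 = 3
  · have : sqrtNeg D = omega D + omega D - 1 := by
      simp only [omega, h3, if_true]
      ring
    rw [this]
    exact sub_mem (add_mem h h) (one_mem _)
  · have : sqrtNeg D = omega D := by simp only [omega, h3, if_false]
    rwa [this]

theorem omega_mem_quadField (D : ℕ) : omega D ∈ quadField D := by
  have h : sqrtNeg D ∈ quadField D := IntermediateField.mem_adjoin_simple_self ℚ _
  unfold omega
  split_ifs
  · exact div_mem (add_mem (one_mem _) h) (ofNat_mem _ 2)
  · exact h

/-- Elements of `ℚ(√(-D))` are quotients of elements of `ℤ[ω]`. -/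
theorem exists_div_of_mem_quadField {D : ℕ} {z : ℂ} (hz : z ∈ quadField D) :
    ∃ a b : quadraticOrder (omega D), b ≠ 0 ∧ z = a / b := by
  induction hz using IntermediateField.adjoin_induction with
  | mem x hx =>
    rw [Set.mem_singleton_iff] at hx
    subst hx
    exact ⟨⟨_, sqrtNeg_mem D⟩, 1, one_ne_zero, by simp⟩
  | algebraMap q =>
    refine ⟨(q.num : quadraticOrder (omega D)), (q.den : quadraticOrder (omega D)),
      Nat.cast_ne_zero.2 q.den_ne_zero, ?_⟩
    push_cast
    rw [eq_ratCast, Rat.cast_def]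
  | add x y _ _ hx hy =>
    obtain ⟨a, b, hb, rfl⟩ := hx
    obtain ⟨c, d, hd, rfl⟩ := hy
    refine ⟨a * d + b * c, b * d, mul_ne_zero hb hd, ?_⟩
    push_cast
    rw [div_add_div _ _ (by simpa using hb) (by simpa using hd)]
  | inv x _ hx =>
    obtain ⟨a, b, hb, rfl⟩ := hx
    rcases eq_or_ne a 0 with rfl | ha
    · exact ⟨0, 1, one_ne_zero, by simp⟩
    · exact ⟨b, a, ha, by rw [inv_div]⟩
  | mul x y _ _ hx hy =>
    obtain ⟨a, b, hb, rfl⟩ := hx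
    obtain ⟨c, d, hd, rfl⟩ := hy
    refine ⟨a * c, b * d, mul_ne_zero hb hd, ?_⟩
    push_cast
    rw [div_mul_div_comm]

theorem isIntegral_omega {D : ℕ} (hD : 0 < D) : IsIntegral ℤ (omega D) := by
  have h := (isQuadraticGenerator_omega hD).mul_self
  refine ⟨Polynomial.X ^ 2 - Polynomial.C (omegaTrace D) * Polynomial.X +
    Polynomial.C (omegaNorm D), by monicity!, ?_⟩
  simp only [Polynomial.eval₂_add, Polynomial.eval₂_sub, Polynomial.eval₂_mul,
    Polynomial.eval₂_pow, Polynomial.eval₂_X, Polynomial.eval₂_C, algebraMap_int_eq,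
    Int.coe_castRingHom]
  linear_combination h

/-- If `ℤ[ω]` is a principal ideal ring, it is the ring of integers of `ℚ(√(-D))`. -/
theorem mem_ringOfIntegersLattice_iff {D : ℕ} (hD : 0 < D)
    [IsPrincipalIdealRing (quadraticOrder (omega D))] (p : ℝ × ℝ) :
    p ∈ ringOfIntegersLattice D ↔ toComplex D p ∈ quadraticOrder (omega D) := by
  constructor
  · rintro ⟨a, ha⟩
    rw [← ha]
    have hint : IsIntegral ℤ ((a : quadField D) : ℂ) :=
      (NumberField.RingOfIntegers.isIntegral_coe a).map
        (IsScalarTower.toAlgHom ℤ (quadField D) ℂ)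
    obtain ⟨b, c, hc, hbc⟩ := exists_div_of_mem_quadField (a : quadField D).2
    have hint' : IsIntegral (quadraticOrder (omega D)) ((a : quadField D) : ℂ) := hint.tower_top
    have hinj : Function.Injective
        (Algebra.ofId (quadraticOrder (omega D)) ℂ) := Subtype.val_injective
    -- The fraction field embeds in ℂ over ℤ[ω], so integral closedness of the principal ideal
    -- domain applies to a = b / c.
    let f : FractionRing (quadraticOrder (omega D)) →ₐ[quadraticOrder (omega D)] ℂ :=
      IsFractionRing.liftAlgHom hinj
    have hf : f (algebraMap _ _ b / algebraMap _ _ c) = ((a : quadField D) : ℂ) := by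
      rw [map_div₀, f.commutes, f.commutes, hbc]
      rfl
    rw [← hf, isIntegral_algHom_iff f f.toRingHom.injective] at hint'
    obtain ⟨y, hy⟩ := IsIntegrallyClosed.algebraMap_eq_of_integral hint'
    rw [← hf, ← hy, f.commutes]
    exact y.2
  · intro hp
    have hK : toComplex D p ∈ quadField D :=
      (Subring.closure_le (t := (quadField D).toSubring)).2
        (Set.singleton_subset_iff.2 (omega_mem_quadField D)) hp
    have hint : IsIntegral ℤ (toComplex D p) :=
      (Subring.closure_le (t := (integralClosure ℤ ℂ).toSubring)).2
        (Set.singleton_subset_iff.2 (isIntegral_omega hD)) hp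
    have hint' : IsIntegral ℤ (⟨toComplex D p, hK⟩ : quadField D) :=
      (isIntegral_algebraMap_iff (A := quadField D) (B := ℂ) Subtype.val_injective).1 hint
    exact ⟨⟨_, hint'⟩, rfl⟩

theorem bijOn_toComplex_shell {D : ℕ} (hD : 0 < D)
    [IsPrincipalIdealRing (quadraticOrder (omega D))] (r : ℝ) :
    Set.BijOn (toComplex D) (shell D r) (complexShell (omega D) r) := by
  refine ⟨fun p hp => ⟨(mem_ringOfIntegersLattice_iff hD p).1 hp.1,
      (mem_ellipse_iff hD r p).1 hp.2⟩,
    (toComplex_injective hD).injOn, fun z hz => ?_⟩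
  obtain ⟨x, y, hxy⟩ := (isQuadraticGenerator_omega hD).mem_iff.1 hz.1
  rw [← toComplex_intCast] at hxy
  subst hxy
  exact ⟨_, ⟨(mem_ringOfIntegersLattice_iff hD _).2 hz.1, (mem_ellipse_iff hD r _).2 hz.2⟩, rfl⟩

/-- The discriminants in question have only one reduced form. -/
theorem eq_one_of_reduced {D : ℕ} (hD : D ∈ ({1, 2, 3, 7, 11, 19, 43, 67, 163} : Set ℕ))
    (a b c : ℤ) (ha : 0 < a) (hb : |b| ≤ a) (hac : a ≤ c)
    (hd : b ^ 2 - 4 * a * c = omegaTrace D ^ 2 - 4 * omegaNorm D) : a = 1 := by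
  have hbound : omegaTrace D ^ 2 - 4 * omegaNorm D ≥ -163 := by
    rcases hD with rfl | rfl | rfl | rfl | rfl | rfl | rfl | rfl | rfl <;>
      norm_num [omegaTrace, omegaNorm]
  have hb2 : b ^ 2 ≤ a ^ 2 := sq_le_sq' (abs_le.1 hb).1 (abs_le.1 hb).2
  -- Reducedness gives 3a² ≤ 4ac - b² ≤ 163.
  have ha7 : a ≤ 7 := by nlinarith
  obtain ⟨hb1, hb3⟩ := abs_le.1 hb
  rcases hD with rfl | rfl | rfl | rfl | rfl | rfl | rfl | rfl | rfl <;>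
    norm_num [omegaTrace, omegaNorm] at hd <;>
    interval_cases a <;> first | rfl | (interval_cases b <;> omega)

theorem isPrincipalIdealRing_quadraticOrder_omega {D : ℕ}
    (hD : D ∈ ({1, 2, 3, 7, 11, 19, 43, 67, 163} : Set ℕ)) (hD0 : 0 < D) :
    IsPrincipalIdealRing (quadraticOrder (omega D)) :=
  (isQuadraticGenerator_omega hD0).isPrincipalIdealRing (eq_one_of_reduced hD)

theorem omega_one : omega 1 = Complex.I := by simp [omega, sqrtNeg]

theorem omega_three_pow_three : omega 3 ^ 3 = -1 := by
  have h := (isQuadraticGenerator_omega (D := 3) (by norm_num)).mul_self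
  norm_num [omegaTrace, omegaNorm] at h
  linear_combination (omega 3 + 1) * h

/-- The elements of norm `1` are roots of unity of order dividing `u_D`. -/
theorem pow_unitCount_eq_one {D : ℕ} (hD : 0 < D) {z : ℂ} (hz : z ∈ complexShell (omega D) 1) :
    z ^ unitCount D = 1 := by
  have h := isQuadraticGenerator_omega hD
  obtain ⟨hz, hr⟩ := hz
  obtain ⟨x, y, rfl⟩ := h.mem_iff.1 hz
  have hn : x ^ 2 + omegaTrace D * x * y + omegaNorm D * y ^ 2 = 1 := by
    have := h.normSq_eq x y
    push_cast at this
    rw [hr] at this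
    exact_mod_cast this.symm
  by_cases h1 : D = 1
  · subst h1
    norm_num [omegaTrace, omegaNorm] at hn
    have hx : x ^ 2 ≤ 1 := by nlinarith [sq_nonneg y]
    have hy : y ^ 2 ≤ 1 := by nlinarith [sq_nonneg x]
    obtain ⟨hx1, hx2⟩ := abs_le.1 ((sq_le_one_iff_abs_le_one x).1 hx)
    obtain ⟨hy1, hy2⟩ := abs_le.1 ((sq_le_one_iff_abs_le_one y).1 hy)
    rw [omega_one]
    have hu : unitCount 1 = 4 := rfl
    rw [hu]
    interval_cases x <;> interval_cases y <;> first | omega | skip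
    all_goals push_cast
    all_goals first | linear_combination Complex.I_pow_four | norm_num
  by_cases h3 : D = 3
  · subst h3
    have hω := h.mul_self
    norm_num [omegaTrace, omegaNorm] at hn hω
    have h3 := omega_three_pow_three
    have h6 : omega 3 ^ 6 = 1 := by linear_combination (omega 3 ^ 3 - 1) * h3
    have hsub : omega 3 - 1 = omega 3 ^ 2 := by linear_combination -hω
    have h12 : (omega 3 - 1) ^ 6 = 1 := by
      rw [hsub, ← pow_mul, mul_comm, pow_mul, h6, one_pow]
    have hx : x ^ 2 ≤ 1 := by nlinarith [sq_nonneg (x + 2 * y)]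
    have hy : y ^ 2 ≤ 1 := by nlinarith [sq_nonneg (2 * x + y)]
    obtain ⟨hx1, hx2⟩ := abs_le.1 ((sq_le_one_iff_abs_le_one x).1 hx)
    obtain ⟨hy1, hy2⟩ := abs_le.1 ((sq_le_one_iff_abs_le_one y).1 hy)
    have hu : unitCount 3 = 6 := rfl
    rw [hu]
    interval_cases x <;> interval_cases y <;> first | omega | skip
    all_goals push_cast
    all_goals first | linear_combination h6 | linear_combination h12 | norm_num
  have hu : unitCount D = 2 := by simp [unitCount, h1, h3]
  -- Outside D = 1, 3 the discriminant is at most -7, so norm 1 forces y = 0 and leaves only ±1.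
  have hd : 7 ≤ 4 * omegaNorm D - omegaTrace D ^ 2 := by
    unfold omegaNorm omegaTrace
    split_ifs <;> omega
  have hy : y = 0 := by
    by_contra hy
    have := sq_pos_of_ne_zero hy
    nlinarith [sq_nonneg (2 * x + omegaTrace D * y)]
  subst hy
  have hx : x ^ 2 = 1 := by simpa using hn
  rw [hu]
  simpa using congrArg (Int.cast : ℤ → ℂ) hx

/-- There is an element of norm `1` that is a primitive `u_D`-th root of unity. -/
theorem exists_isPrimitiveRoot_unitCount {D : ℕ} (hD : 0 < D) :
    ∃ ζ ∈ complexShell (omega D) 1, IsPrimitiveRoot ζ (unitCount D) := by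
  have h := isQuadraticGenerator_omega hD
  have hmem : omega D ∈ quadraticOrder (omega D) := Subring.subset_closure (Set.mem_singleton _)
  have hns : Complex.normSq (omega D) = omegaNorm D := by
    simpa using h.normSq_eq 0 1
  by_cases h1 : D = 1
  · subst h1
    refine ⟨omega 1, ⟨hmem, by rw [hns]; norm_num [omegaNorm]⟩, ?_⟩
    rw [omega_one]
    exact Complex.isPrimitiveRoot_I
  by_cases h3 : D = 3
  · subst h3
    refine ⟨omega 3, ⟨hmem, by rw [hns]; norm_num [omegaNorm]⟩, ?_⟩
    have hω := h.mul_self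
    norm_num [omegaTrace, omegaNorm] at hω
    have h3 := omega_three_pow_three
    -- By ω² = ω - 1 and ω³ = -1, each equation ω^l = 1 with 0 < l < 6 makes ω an integer, except l
    -- = 3, which gives -1 = 1.
    have hne : ∀ n : ℤ, omega 3 ≠ n := fun n hn => h.im_ne_zero (by rw [hn]; simp)
    refine IsPrimitiveRoot.mk_of_lt (omega 3) (by norm_num [unitCount]) ?_ fun l hl0 hl hl1 => ?_
    · change omega 3 ^ 6 = 1
      linear_combination (omega 3 ^ 3 - 1) * h3
    · change l < 6 at hl
      interval_cases l
      · exact hne 1 (by push_cast; linear_combination hl1)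
      · exact hne 2 (by push_cast; linear_combination hl1 - hω)
      · rw [h3] at hl1
        norm_num at hl1
      · exact hne (-1) (by push_cast; linear_combination -hl1 + omega 3 * h3)
      · exact hne 0 (by push_cast; linear_combination -hl1 - hω + omega 3 ^ 2 * h3)
  refine ⟨-1, ⟨neg_mem (one_mem _), by simp⟩, ?_⟩
  have hu : unitCount D = 2 := by simp [unitCount, h1, h3]
  rw [hu]
  exact IsPrimitiveRoot.neg_one 0 (by norm_num)

end Omega

/-! ### Transfer to ellipsoidal designs -/

section Design

variable {D : ℕ}

theorem eval_omegaPow (D j : ℕ) (p : ℝ × ℝ) :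
    eval ![(p.1 : ℂ), (p.2 : ℂ)] (omegaPow D j) = toComplex D p ^ j := by
  simp [omegaPow, toComplex]

theorem finite_shell (hD : 0 < D) [IsPrincipalIdealRing (quadraticOrder (omega D))] (r : ℝ) :
    (shell D r).Finite :=
  (bijOn_toComplex_shell hD r).finite_iff_finite.2 ((isQuadraticGenerator_omega hD).finite_normSq r)

theorem finsum_shell_pow (hD : 0 < D) [IsPrincipalIdealRing (quadraticOrder (omega D))] (r : ℝ)
    (j : ℕ) : ∑ᶠ p ∈ shell D r, toComplex D p ^ j = ∑ᶠ z ∈ complexShell (omega D) r, z ^ j :=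
  finsum_mem_eq_of_bijOn _ (bijOn_toComplex_shell hD r) fun _ _ => rfl

theorem finsum_shell_re (hD : 0 < D) [IsPrincipalIdealRing (quadraticOrder (omega D))] (r : ℝ)
    (j : ℕ) : ∑ᶠ p ∈ shell D r, (toComplex D p ^ j).re =
      (∑ᶠ z ∈ complexShell (omega D) r, z ^ j).re := by
  rw [← finsum_shell_pow hD]
  exact (Complex.reAddGroupHom.map_finsum_mem _ (finite_shell hD r)).symm

theorem finsum_shell_im (hD : 0 < D) [IsPrincipalIdealRing (quadraticOrder (omega D))] (r : ℝ)
    (j : ℕ) : ∑ᶠ p ∈ shell D r, (toComplex D p ^ j).im =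
      (∑ᶠ z ∈ complexShell (omega D) r, z ^ j).im := by
  rw [← finsum_shell_pow hD]
  exact (Complex.imAddGroupHom.map_finsum_mem _ (finite_shell hD r)).symm

theorem isDesign_shell (hD : 0 < D) [IsPrincipalIdealRing (quadraticOrder (omega D))] {r : ℝ}
    (hne : (shell D r).Nonempty) : IsDesign D r (shell D r) (designSet D) := by
  refine ⟨finite_shell hD r, hne, Set.inter_subset_right, fun j hj P hP => ?_⟩
  obtain ⟨ζ, hζ, hprim⟩ := exists_isPrimitiveRoot_unitCount hD
  have h0 : ∑ᶠ z ∈ complexShell (omega D) r, z ^ (j : ℕ) = 0 :=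
    (isQuadraticGenerator_omega hD).finsum_complexShell_eq_zero hζ
      (fun h => hj ((hprim.pow_eq_one_iff_dvd _).1 h)) r
  have hfin := finite_shell hD r
  induction hP using Submodule.span_induction with
  | mem P hP =>
    rcases hP with rfl | rfl
    · simp only [eval_rePart, eval_omegaPow]
      rw [finsum_shell_re hD, h0, Complex.zero_re]
    · simp only [eval_imPart, eval_omegaPow]
      rw [finsum_shell_im hD, h0, Complex.zero_im]
  | zero => simp
  | add P Q _ _ hP hQ =>
    simp only [map_add]
    rw [finsum_mem_add_distrib hfin, hP, hQ, add_zero]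
  | smul a P _ hP =>
    simp only [smul_eval]
    rw [← mul_finsum_mem, hP, mul_zero]

theorem finsum_shell_re_ne_zero (hD : 0 < D) [IsPrincipalIdealRing (quadraticOrder (omega D))]
    {r : ℝ} (hr : 0 < r) (hne : (shell D r).Nonempty) {j : ℕ} (hj : j ≠ 0)
    (hdvd : unitCount D ∣ j) : ∑ᶠ p ∈ shell D r, (toComplex D p ^ j).re ≠ 0 := by
  have h := isQuadraticGenerator_omega hD
  rw [finsum_shell_re hD]
  have h1 : ∑ᶠ z ∈ complexShell (omega D) r, z ^ j ≠ 0 := by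
    refine h.finsum_complexShell_ne_zero hj (fun z hz => ?_) hr.ne' ?_
    · obtain ⟨k, rfl⟩ := hdvd
      rw [pow_mul, pow_unitCount_eq_one hD hz, one_pow]
    · obtain ⟨p, hp⟩ := hne
      exact ⟨_, (bijOn_toComplex_shell hD r).mapsTo hp⟩
  intro h0
  exact h1 (Complex.ext h0 (Complex.conj_eq_iff_im.1 (h.conj_finsum_complexShell r j)))

end Design

end EllipsoidalDesign

end

theorem theorem2 (D : ℕ) (hD : D ∈ ({1, 2, 3, 7, 11, 19, 43, 67, 163} : Set ℕ))
    (r : ℝ) (hr : 0 < r) (hne : (EllipsoidalDesign.shell D r).Nonempty) :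
    EllipsoidalDesign.IsDesign D r (EllipsoidalDesign.shell D r)
        (EllipsoidalDesign.designSet D) ∧
      EllipsoidalDesign.HasStrength D r (EllipsoidalDesign.shell D r)
        (EllipsoidalDesign.designSet D) ∧
      ∀ j : ℕ+, EllipsoidalDesign.unitCount D ∣ (j : ℕ) →
        ∑ᶠ p ∈ EllipsoidalDesign.shell D r,
          ((EllipsoidalDesign.toComplex D p) ^ (j : ℕ)).re ≠ 0 := by
  have hD0 : 0 < D := by
    rcases hD with rfl | rfl | rfl | rfl | rfl | rfl | rfl | rfl | rfl <;> norm_num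
  have := EllipsoidalDesign.isPrincipalIdealRing_quadraticOrder_omega hD hD0
  have hdes := EllipsoidalDesign.isDesign_shell hD0 hne
  have hsum : ∀ j : ℕ+, EllipsoidalDesign.unitCount D ∣ (j : ℕ) →
      ∑ᶠ p ∈ EllipsoidalDesign.shell D r,
        ((EllipsoidalDesign.toComplex D p) ^ (j : ℕ)).re ≠ 0 := fun j hj =>
    EllipsoidalDesign.finsum_shell_re_ne_zero hD0 hr hne j.ne_zero hj
  -- Maximality: Re (x + ωy)^j lies in H_{D,j} and has nonzero sum when u_D ∣ j, so no such j
  -- belongs to a design set T.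
  refine ⟨hdes, ⟨hdes, fun T hT _ j hj hdvd => hsum j hdvd ?_⟩, hsum⟩
  have h := hT.2.2.2 j hj _ (Submodule.subset_span (Set.mem_insert _ _))
  simpa only [EllipsoidalDesign.eval_rePart, EllipsoidalDesign.eval_omegaPow] using h
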